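/- All graphs are finite, undirected and simple (no loops); the graph without vertices is allowed. Let $p$ be a prime, let $k \ge 0$ be an integer, and let $G$ and $H$ be graphs. For graphs $F, G$ let $\hom(F,G)$ be the number of homomorphisms from $F$ to $G$, that is, of maps $h \colon V(F) \to V(G)$ with $h(u)h(v) \in E(G)$ for every $uv \in E(F)$. A tree decomposition of $F$ is a pair $(T,\beta)$ of a finite tree $T$ and a map $\beta \colon V(T) \to 2^{V(F)}$ such that every vertex of $F$ lies in some $\beta(t)$, both ends of every edge of $F$ lie in a common $\beta(t)$, and for every $u \in V(F)$ the set $\{t \in V(T) : u \in \beta(t)\}$ induces a connected subgraph of $T$. Its width is $\max_{t} |\beta(t)| - 1$, and the treewidth of $F$ is the minimal width of a tree decomposition of $F$. Let $\mathsf{C}^{k+1}_p$ be the set of formulas built, using only $k+1$ variables (which may be re-quantified), from atoms $x = y$ and $E(x,y)$ by means of $\neg$, $\wedge$, $\vee$ and the quantifiers $\exists^{c} x$ for $c \in \mathbb{F}_p$, where $\exists^{c} x.\,\varphi$ holds in a graph if the number of vertices $a$ such that $\varphi$ holds with $x$ interpreted as $a$ is congruent to $c$ modulo $p$. A sentence is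 a formula without free variables. **Theorem.** The following are equivalent: 1. $\hom(F,G) \equiv \hom(F,H) \pmod p$ for every graph $F$ of treewidth at most $k$; 2. $G$ and $H$ satisfy the same sentences of $\mathsf{C}^{k+1}_p$. -/

import Mathlib

namespace ModHom

/-- A tree decomposition of a graph `F`, with finite node set `T`. -/
structure TreeDecomposition {U : Type*} (F : SimpleGraph U) (T : Type*) where
  tree : SimpleGraph T
  isTree : tree.IsTree
  bag : T → Finset U
  cover_vertex : ∀ u, ∃ t, u ∈ bag t
  cover_edge : ∀ u v, F.Adj u v → ∃ t, u ∈ bag t ∧ v ∈ bag t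
  connected : ∀ u, (tree.induce {t | u ∈ bag t}).Connected

/-- The width `max |bag t| - 1` (an integer: it is `-1` when all bags are empty). -/
def TreeDecomposition.width {U : Type*} {F : SimpleGraph U} {T : Type*} [Fintype T]
    (D : TreeDecomposition F T) : ℤ :=
  ((Finset.univ.sup fun t => (D.bag t).card : ℕ) : ℤ) - 1

/-- The widths of all tree decompositions of `F` (over finite trees). -/
def widths {U : Type*} (F : SimpleGraph U) : Set ℤ :=
  {w | ∃ (T : Type) (_ : Fintype T) (D : TreeDecomposition F T), D.width = w}

/-- The treewidth of a finite graph: the minimal width of a tree decomposition. -/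
noncomputable def treewidth {U : Type*} (F : SimpleGraph U) : ℤ :=
  sInf (widths F)

/-- The decomposition of a finite graph into a single bag. -/
def TreeDecomposition.single {U : Type*} [Fintype U] (F : SimpleGraph U) :
    TreeDecomposition F Unit where
  tree := ⊥
  isTree := SimpleGraph.IsTree.of_subsingleton
  bag := fun _ => Finset.univ
  cover_vertex := fun u => ⟨(), Finset.mem_univ u⟩
  cover_edge := fun u v _ => ⟨(), Finset.mem_univ u, Finset.mem_univ v⟩
  connected := fun u => by
    have : Nonempty {t : Unit | u ∈ (Finset.univ : Finset U)} := ⟨⟨(), Finset.mem_univ u⟩⟩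
    exact (SimpleGraph.IsTree.of_subsingleton).connected

/-- For finite graphs the infimum defining the treewidth is a minimum. -/
theorem treewidth_mem {U : Type*} [Finite U] (F : SimpleGraph U) : treewidth F ∈ widths F := by
  have := Fintype.ofFinite U
  refine Int.csInf_mem ⟨_, Unit, inferInstance, TreeDecomposition.single F, rfl⟩ ⟨-1, ?_⟩
  rintro w ⟨T, _, D, rfl⟩
  simp only [TreeDecomposition.width]
  omega

/-- The number of homomorphisms from `F` to `G`. -/
noncomputable def hom {U V : Type*} (F : SimpleGraph U) (G : SimpleGraph V) : ℕ :=
  Nat.card (F →g G)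

/-- `G` and `H` are homomorphism indistinguishable modulo `m` over all finite graphs of treewidth
at most `k`. -/
def HomIndistinguishableTW {V W : Type*} (m k : ℕ) (G : SimpleGraph V) (H : SimpleGraph W) :
    Prop :=
  ∀ (U : Type) [Finite U] (F : SimpleGraph U), treewidth F ≤ (k : ℤ) →
    hom F G ≡ hom F H [MOD m]

/-- Formulas, with variables from `α`, of first-order logic over the vocabulary `{E}` of graphs
with mod-`p` counting quantifiers `∃^c x. φ` for `c` in `ℤ/p`. -/
inductive Formula (p : ℕ) (α : Type*) where
  | eq (x y : α) : Formula p α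
  | edge (x y : α) : Formula p α
  | neg (φ : Formula p α) : Formula p α
  | and (φ ψ : Formula p α) : Formula p α
  | or (φ ψ : Formula p α) : Formula p α
  | existsMod (c : ZMod p) (x : α) (φ : Formula p α) : Formula p α

namespace Formula

/-- The free variables of a formula. -/
def freeVars {p : ℕ} {α : Type*} : Formula p α → Set α
  | eq x y => {x, y}
  | edge x y => {x, y}
  | neg φ => φ.freeVars
  | and φ ψ => φ.freeVars ∪ ψ.freeVars
  | or φ ψ => φ.freeVars ∪ ψ.freeVars
  | existsMod _ x φ => φ.freeVars \ {x}

/-- A sentence is a formula without free variables. -/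
def IsSentence {p : ℕ} {α : Type*} (φ : Formula p α) : Prop :=
  φ.freeVars = ∅

/-- Satisfaction of a formula in `G` under a partial assignment `s` (`s x = none`: the variable
`x` has no value). It is only of interest if `s` is defined on all free variables. Assignments are
partial so that sentences can be evaluated (at the empty assignment) in every graph, including the
graph without vertices, which has no total assignment. -/
def Realize {p : ℕ} {α : Type*} [DecidableEq α] {V : Type*} (G : SimpleGraph V) :
    Formula p α → (α → Option V) → Prop
  | eq x y, s => ∃ a, s x = some a ∧ s y = some a
  | edge x y, s => ∃ a b, s x = some a ∧ s y = some b ∧ G.Adj a b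
  | neg φ, s => ¬ φ.Realize G s
  | and φ ψ, s => φ.Realize G s ∧ ψ.Realize G s
  | or φ ψ, s => φ.Realize G s ∨ ψ.Realize G s
  | existsMod c x φ, s =>
      (Nat.card {a : V // φ.Realize G (Function.update s x (some a))} : ZMod p) = c

/-- Satisfaction only depends on the values of the free variables. -/
theorem realize_congr {p : ℕ} {α : Type*} [DecidableEq α] {V : Type*} (G : SimpleGraph V)
    (φ : Formula p α) : ∀ s t : α → Option V, (∀ x ∈ φ.freeVars, s x = t x) →
      (φ.Realize G s ↔ φ.Realize G t) := by
  induction φ with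
  | eq x y =>
    intro s t h
    simp only [Realize, h x (by simp [freeVars]), h y (by simp [freeVars])]
  | edge x y =>
    intro s t h
    simp only [Realize, h x (by simp [freeVars]), h y (by simp [freeVars])]
  | neg φ ih =>
    intro s t h
    exact not_congr (ih s t h)
  | and φ ψ ih1 ih2 =>
    intro s t h
    exact and_congr (ih1 s t fun x hx => h x (Or.inl hx)) (ih2 s t fun x hx => h x (Or.inr hx))
  | or φ ψ ih1 ih2 =>
    intro s t h
    exact or_congr (ih1 s t fun x hx => h x (Or.inl hx)) (ih2 s t fun x hx => h x (Or.inr hx))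
  | existsMod c x φ ih =>
    intro s t h
    have key : ∀ a : V, φ.Realize G (Function.update s x (some a)) ↔
        φ.Realize G (Function.update t x (some a)) := by
      intro a
      refine ih _ _ fun y hy => ?_
      by_cases hyx : y = x
      · subst hyx
        simp
      · simp only [Function.update_of_ne hyx]
        exact h y ⟨hy, hyx⟩
    simp only [Realize, key]

/-- Truth of a sentence in a graph. -/
def Holds {p : ℕ} {α : Type*} [DecidableEq α] {V : Type*} (G : SimpleGraph V)
    (φ : Formula p α) : Prop :=
  φ.Realize G fun _ => none

/-- The truth value of a sentence is its value under any (for instance any total) assignment. -/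
theorem IsSentence.holds_iff {p : ℕ} {α : Type*} [DecidableEq α] {V : Type*} (G : SimpleGraph V)
    {φ : Formula p α} (hφ : φ.IsSentence) (s : α → Option V) : φ.Holds G ↔ φ.Realize G s :=
  realize_congr G φ _ _ fun x hx => by
    rw [hφ] at hx
    exact hx.elim

end Formula

/-- `G` and `H` satisfy the same sentences of the `n`-variable fragment of first-order logic with
mod-`p` counting quantifiers. -/
def ModCountingEquiv {V W : Type*} (n p : ℕ) (G : SimpleGraph V) (H : SimpleGraph W) : Prop :=
  ∀ φ : Formula p (Fin n), φ.IsSentence → (φ.Holds G ↔ φ.Holds H)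

end ModHom

namespace ModHom

open Classical in
/-- The number `1` if `P` holds and `0` otherwise. -/
noncomputable def iverson (P : Prop) : ℕ := if P then 1 else 0

theorem iverson_of {P : Prop} (h : P) : iverson P = 1 := if_pos h

theorem iverson_of_not {P : Prop} (h : ¬ P) : iverson P = 0 := if_neg h

/-- Terms describing homomorphism counts of labelled graphs of bounded treewidth. -/
inductive Term (α : Type*) where
  | one : Term α
  | eq (x y : α) : Term α
  | edge (x y : α) : Term α
  | mul (t u : Term α) : Term α
  | sum (x : α) (t : Term α) : Term α

namespace Term

variable {α : Type*}

/-- The free variables of a term. -/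
def freeVars : Term α → Set α
  | one => ∅
  | eq x y => {x, y}
  | edge x y => {x, y}
  | mul t u => t.freeVars ∪ u.freeVars
  | sum x t => t.freeVars \ {x}

/-- The value of a term in a graph under a partial assignment. -/
noncomputable def eval [DecidableEq α] {V : Type*} [Fintype V] (G : SimpleGraph V) :
    Term α → (α → Option V) → ℕ
  | one, _ => 1
  | eq x y, s => iverson (∃ a, s x = some a ∧ s y = some a)
  | edge x y, s => iverson (∃ a b, s x = some a ∧ s y = some b ∧ G.Adj a b)
  | mul t u, s => t.eval G s * u.eval G s
  | sum x t, s => ∑ a, t.eval G (Function.update s x (some a))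

theorem eval_congr [DecidableEq α] {V : Type*} [Fintype V] (G : SimpleGraph V) (t : Term α) :
    ∀ s s' : α → Option V, (∀ x ∈ t.freeVars, s x = s' x) → t.eval G s = t.eval G s' := by
  induction t with
  | one => intro s s' _; rfl
  | eq x y =>
    intro s s' h
    simp only [eval, h x (by simp [freeVars]), h y (by simp [freeVars])]
  | edge x y =>
    intro s s' h
    simp only [eval, h x (by simp [freeVars]), h y (by simp [freeVars])]
  | mul t u iht ihu =>
    intro s s' h
    simp only [eval, iht s s' fun x hx => h x (Or.inl hx), ihu s s' fun x hx => h x (Or.inr hx)]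
  | sum x t ih =>
    intro s s' h
    refine Finset.sum_congr rfl fun a _ => ih _ _ fun y hy => ?_
    by_cases hyx : y = x
    · subst hyx
      simp
    · simp only [Function.update_of_ne hyx]
      exact h y ⟨hy, hyx⟩

end Term

/-- A property of graphs with partial assignments is definable with free variables in `X`. -/
def Definable (p : ℕ) {α : Type*} [DecidableEq α] (X : Set α)
    (P : ∀ (V : Type) [Fintype V], SimpleGraph V → (α → Option V) → Prop) : Prop :=
  ∃ φ : Formula p α, φ.freeVars ⊆ X ∧
    ∀ (V : Type) [Fintype V] (G : SimpleGraph V) s, φ.Realize G s ↔ P V G s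

namespace Definable

variable {p : ℕ} {α : Type*} [DecidableEq α] {X Y : Set α}
  {P Q : ∀ (V : Type) [Fintype V], SimpleGraph V → (α → Option V) → Prop}

theorem congr (h : Definable p X P)
    (hPQ : ∀ (V : Type) [Fintype V] (G : SimpleGraph V) s, P V G s ↔ Q V G s) :
    Definable p X Q := by
  obtain ⟨φ, h1, h2⟩ := h
  exact ⟨φ, h1, fun V _ G s => (h2 V G s).trans (hPQ V G s)⟩

theorem mono (h : Definable p X P) (hXY : X ⊆ Y) : Definable p Y P := by
  obtain ⟨φ, h1, h2⟩ := h
  exact ⟨φ, h1.trans hXY, h2⟩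

theorem not (h : Definable p X P) : Definable p X fun V _ G s => ¬ P V G s := by
  obtain ⟨φ, h1, h2⟩ := h
  exact ⟨.neg φ, h1, fun V _ G s => not_congr (h2 V G s)⟩

theorem and (h : Definable p X P) (h' : Definable p X Q) :
    Definable p X fun V _ G s => P V G s ∧ Q V G s := by
  obtain ⟨φ, h1, h2⟩ := h
  obtain ⟨ψ, h3, h4⟩ := h'
  exact ⟨.and φ ψ, Set.union_subset h1 h3, fun V _ G s => and_congr (h2 V G s) (h4 V G s)⟩

theorem or (h : Definable p X P) (h' : Definable p X Q) :
    Definable p X fun V _ G s => P V G s ∨ Q V G s := by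
  obtain ⟨φ, h1, h2⟩ := h
  obtain ⟨ψ, h3, h4⟩ := h'
  exact ⟨.or φ ψ, Set.union_subset h1 h3, fun V _ G s => or_congr (h2 V G s) (h4 V G s)⟩

theorem false [Nonempty α] : Definable p X fun _ _ _ _ => False := by
  obtain ⟨x⟩ := ‹Nonempty α›
  let φ : Formula p α := .existsMod 0 x (.eq x x)
  exact ⟨.and φ (.neg φ), by simp [φ, Formula.freeVars], fun V _ G s => by
    simp [Formula.Realize]⟩

theorem const [Nonempty α] (c : Prop) : Definable p X fun _ _ _ _ => c := by
  by_cases h : c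
  · exact false.not.congr (by simp [h])
  · exact false.congr (by simp [h])

theorem exists_mem [Nonempty α] {ι : Type*} (S : Finset ι)
    {R : ι → ∀ (V : Type) [Fintype V], SimpleGraph V → (α → Option V) → Prop}
    (h : ∀ i, Definable p X (R i)) :
    Definable p X fun V _ G s => ∃ i ∈ S, R i V G s := by
  classical
  induction S using Finset.induction_on with
  | empty => exact false.congr (by simp)
  | insert i S _ ih => exact ((h i).or ih).congr (by simp)

theorem exists_fintype [Nonempty α] {ι : Type*} [Fintype ι]
    {R : ι → ∀ (V : Type) [Fintype V], SimpleGraph V → (α → Option V) → Prop}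
    (h : ∀ i, Definable p X (R i)) :
    Definable p X fun V _ G s => ∃ i, R i V G s :=
  (exists_mem Finset.univ h).congr (by simp)

theorem forall_fintype [Nonempty α] {ι : Type*} [Fintype ι]
    {R : ι → ∀ (V : Type) [Fintype V], SimpleGraph V → (α → Option V) → Prop}
    (h : ∀ i, Definable p X (R i)) :
    Definable p X fun V _ G s => ∀ i, R i V G s :=
  (exists_fintype fun i => (h i).not).not.congr (by simp)

theorem card_eq (h : Definable p X P) (c : ZMod p) (x : α) :
    Definable p (X \ {x}) fun V _ G s =>
      (Nat.card {a : V // P V G (Function.update s x (some a))} : ZMod p) = c := by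
  obtain ⟨φ, h1, h2⟩ := h
  refine ⟨.existsMod c x φ, Set.sdiff_subset_sdiff_left h1, fun V _ G s => ?_⟩
  simp only [Formula.Realize, h2]

end Definable

/-- That a term takes a given value modulo `p` is definable. -/
theorem Term.definable_eval_eq {p : ℕ} [NeZero p] {α : Type*} [DecidableEq α] [Nonempty α]
    (t : Term α) : ∀ c : ZMod p,
      Definable p t.freeVars fun _ _ G s => (t.eval G s : ZMod p) = c := by
  have atom : ∀ (X : Set α) (P : ∀ (V : Type) [Fintype V], SimpleGraph V → (α → Option V) → Prop)
      (_ : Definable p X P) (c : ZMod p), Definable p X fun V _ G s =>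
        (iverson (P V G s) : ZMod p) = c := by
    intro X P h c
    refine ((h.and (.const (1 = c))).or (h.not.and (.const (0 = c)))).congr fun V _ G s => ?_
    by_cases hP : P V G s <;> simp [iverson, hP]
  induction t with
  | one => exact fun c => (Definable.const (1 = c)).congr (by simp [eval])
  | eq x y =>
    exact fun c => atom {x, y} (fun V _ G s => ∃ a, s x = some a ∧ s y = some a)
      ⟨.eq x y, le_rfl, fun V _ G s => Iff.rfl⟩ c
  | edge x y =>
    exact fun c => atom {x, y}
      (fun V _ G s => ∃ a b, s x = some a ∧ s y = some b ∧ G.Adj a b)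
      ⟨.edge x y, le_rfl, fun V _ G s => Iff.rfl⟩ c
  | mul t u iht ihu =>
    intro c
    refine (Definable.exists_fintype (ι := ZMod p × ZMod p) fun i =>
      (((iht i.1).mono (Set.subset_union_left (t := u.freeVars))).and
        ((ihu i.2).mono (Set.subset_union_right (s := t.freeVars)))).and
        (.const (i.1 * i.2 = c))).congr fun V _ G s => ?_
    simp [eval]
  | sum x t ih =>
    intro c
    refine (Definable.exists_fintype (ι := ZMod p → ZMod p) fun m =>
      (Definable.forall_fintype fun d : ZMod p => (ih d).card_eq (m d) x).and
        (.const (∑ d, d * m d = c))).congr fun V _ G s => ?_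
    have key : (((sum x t).eval G s : ℕ) : ZMod p) = ∑ d : ZMod p, d *
        (Nat.card {a : V // (t.eval G (Function.update s x (some a)) : ZMod p) = d} : ZMod p) := by
      classical
      simp only [eval, Nat.cast_sum]
      rw [← Finset.sum_fiberwise (s := Finset.univ)
        (g := fun a => (t.eval G (Function.update s x (some a)) : ZMod p))]
      refine Finset.sum_congr rfl fun d _ => ?_
      rw [Finset.sum_congr rfl (g := fun _ => d) (by simp), Finset.sum_const, nsmul_eq_mul,
        mul_comm, Nat.card_eq_fintype_card, Fintype.card_subtype]
    rw [key]
    constructor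
    · rintro ⟨m, h1, h2⟩
      simpa only [h1] using h2
    · exact fun h => ⟨_, fun d => rfl, h⟩

/-- The indicator function of a formula in two graphs. -/
noncomputable def Formula.indicator {p : ℕ} {α : Type*} [DecidableEq α] {V W : Type*}
    (G : SimpleGraph V) (H : SimpleGraph W) (φ : Formula p α) :
    ((α → Option V) → ZMod p) × ((α → Option W) → ZMod p) :=
  (fun s => iverson (φ.Realize G s), fun s => iverson (φ.Realize H s))

namespace Term

/-- The values modulo `p` of a term in two graphs. -/
noncomputable def evalPair (p : ℕ) {α : Type*} [DecidableEq α] {V W : Type*}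
    [Fintype V] [Fintype W] (G : SimpleGraph V) (H : SimpleGraph W) (t : Term α) :
    ((α → Option V) → ZMod p) × ((α → Option W) → ZMod p) :=
  (fun s => (t.eval G s : ZMod p), fun s => (t.eval H s : ZMod p))

/-- Summation over the values of a variable, in two graphs. -/
noncomputable def sumPair (p : ℕ) {α : Type*} [DecidableEq α] {V W : Type*}
    [Fintype V] [Fintype W] (x : α) :
    ((α → Option V) → ZMod p) × ((α → Option W) → ZMod p) →ₗ[ZMod p]
    ((α → Option V) → ZMod p) × ((α → Option W) → ZMod p) where
  toFun f := (fun s => ∑ a, f.1 (Function.update s x (some a)),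
    fun s => ∑ a, f.2 (Function.update s x (some a)))
  map_add' f g := by
    ext s <;> simp [Finset.sum_add_distrib]
  map_smul' c f := by
    ext s <;> simp [Finset.mul_sum]

variable {p : ℕ} {α : Type*} [DecidableEq α] {V W : Type*}
    [Fintype V] [Fintype W] {G : SimpleGraph V} {H : SimpleGraph W}

theorem one_mem_span :
    1 ∈ Submodule.span (ZMod p) (Set.range (evalPair (α := α) p G H)) :=
  Submodule.subset_span ⟨one, by ext <;> simp [evalPair, eval]⟩

theorem mul_mem_span {f g : ((α → Option V) → ZMod p) × ((α → Option W) → ZMod p)}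
    (hf : f ∈ Submodule.span (ZMod p) (Set.range (evalPair p G H)))
    (hg : g ∈ Submodule.span (ZMod p) (Set.range (evalPair p G H))) :
    f * g ∈ Submodule.span (ZMod p) (Set.range (evalPair p G H)) := by
  have h := Submodule.mul_mem_mul hf hg
  rw [Submodule.span_mul_span] at h
  refine Submodule.span_mono ?_ h
  rintro _ ⟨_, ⟨t, rfl⟩, _, ⟨u, rfl⟩, rfl⟩
  exact ⟨mul t u, by ext <;> simp [evalPair, eval]⟩

theorem pow_mem_span {f : ((α → Option V) → ZMod p) × ((α → Option W) → ZMod p)}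
    (hf : f ∈ Submodule.span (ZMod p) (Set.range (evalPair p G H))) (n : ℕ) :
    f ^ n ∈ Submodule.span (ZMod p) (Set.range (evalPair p G H)) := by
  induction n with
  | zero => simpa using one_mem_span
  | succ n ih => exact pow_succ f n ▸ mul_mem_span ih hf

theorem sumPair_mem_span {f : ((α → Option V) → ZMod p) × ((α → Option W) → ZMod p)}
    (hf : f ∈ Submodule.span (ZMod p) (Set.range (evalPair p G H))) (x : α) :
    sumPair p x f ∈ Submodule.span (ZMod p) (Set.range (evalPair p G H)) := by
  have h := Submodule.mem_map_of_mem (f := sumPair p x) hf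
  rw [Submodule.map_span] at h
  refine Submodule.span_mono ?_ h
  rintro _ ⟨_, ⟨t, rfl⟩, rfl⟩
  exact ⟨sum x t, by ext <;> simp [evalPair, eval, sumPair]⟩

/-- The indicator function of a formula is a linear combination of terms. -/
theorem indicator_mem_span [Fact p.Prime] (φ : Formula p α) :
    φ.indicator G H ∈ Submodule.span (ZMod p) (Set.range (evalPair p G H)) := by
  classical
  induction φ with
  | eq x y =>
    refine Submodule.subset_span ⟨eq x y, ?_⟩
    ext s <;> simp [evalPair, eval, Formula.indicator, Formula.Realize]
  | edge x y =>
    refine Submodule.subset_span ⟨edge x y, ?_⟩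
    ext s <;> simp [evalPair, eval, Formula.indicator, Formula.Realize]
  | neg φ ih =>
    convert Submodule.sub_mem _ one_mem_span ih using 1
    ext s
    · by_cases h : φ.Realize G s <;> simp [Formula.indicator, Formula.Realize, iverson, h]
    · by_cases h : φ.Realize H s <;> simp [Formula.indicator, Formula.Realize, iverson, h]
  | and φ ψ ih1 ih2 =>
    convert mul_mem_span ih1 ih2 using 1
    ext s
    · by_cases h : φ.Realize G s <;> simp [Formula.indicator, Formula.Realize, iverson, h]
    · by_cases h : φ.Realize H s <;> simp [Formula.indicator, Formula.Realize, iverson, h]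
  | or φ ψ ih1 ih2 =>
    convert Submodule.sub_mem _ (Submodule.add_mem _ ih1 ih2) (mul_mem_span ih1 ih2) using 1
    ext s
    · by_cases h : φ.Realize G s <;> simp [Formula.indicator, Formula.Realize, iverson, h]
    · by_cases h : φ.Realize H s <;> simp [Formula.indicator, Formula.Realize, iverson, h]
  | existsMod c x φ ih =>
    convert Submodule.sub_mem _ one_mem_span (pow_mem_span (Submodule.sub_mem _
      (sumPair_mem_span ih x) (Submodule.smul_mem _ c one_mem_span)) (p - 1)) using 1
    ext s
    · simp [Formula.indicator, Formula.Realize, iverson, sumPair, ZMod.pow_card_sub_one, sub_eq_zero,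
        Fintype.card_subtype]
      split_ifs <;> simp_all
    · simp [Formula.indicator, Formula.Realize, iverson, sumPair, ZMod.pow_card_sub_one, sub_eq_zero,
        Fintype.card_subtype]
      split_ifs <;> simp_all

/-- Graphs in which all terms have the same values satisfy the same formulas. -/
theorem holds_iff_of_eval_eq [Fact p.Prime]
    (h : ∀ t : Term α, (t.eval G (fun _ => none) : ZMod p) = t.eval H fun _ => none)
    (φ : Formula p α) : φ.Holds G ↔ φ.Holds H := by
  classical
  have key : ∀ f ∈ Submodule.span (ZMod p) (Set.range (evalPair (α := α) p G H)),
      f.1 (fun _ => none) = f.2 fun _ => none := by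
    intro f hf
    induction hf using Submodule.span_induction with
    | mem f hf =>
      obtain ⟨t, rfl⟩ := hf
      exact h t
    | zero => rfl
    | add f g _ _ h1 h2 => simp [h1, h2]
    | smul c f _ h1 => simp [h1]
  have := key _ (indicator_mem_span φ)
  by_cases h1 : φ.Realize G fun _ => none <;> by_cases h2 : φ.Realize H fun _ => none <;>
    simp_all [Formula.Holds, Formula.indicator, iverson]

end Term

theorem isAcyclic_sum {V W : Type*} {G : SimpleGraph V} {H : SimpleGraph W} (hG : G.IsAcyclic)
    (hH : H.IsAcyclic) : (G ⊕g H).IsAcyclic := by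
  rw [SimpleGraph.isAcyclic_iff_forall_adj_isBridge]
  rintro (a | a) (b | b) hab
  · have h := SimpleGraph.isAcyclic_iff_forall_adj_isBridge.1 hG
      (SimpleGraph.sum_adj_inl.1 hab)
    rw [SimpleGraph.isBridge_iff] at h ⊢
    intro hr
    apply h
    obtain ⟨w⟩ := hr
    suffices ∀ x y, ((G ⊕g H).deleteEdges {s(Sum.inl a, Sum.inl b)}).Walk x y → ∀ c d, x = .inl c →
        y = .inl d → (G.deleteEdges {s(a, b)}).Reachable c d from this _ _ w a b rfl rfl
    intro x y w
    induction w with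
    | nil => rintro c d rfl h; cases h; rfl
    | @cons u v y hadj w ih =>
      rintro c d rfl rfl
      rcases v with v | v
      · refine SimpleGraph.Reachable.trans (SimpleGraph.Adj.reachable ?_) (ih v d rfl rfl)
        simpa [SimpleGraph.deleteEdges_adj] using hadj
      · simp [SimpleGraph.deleteEdges_adj] at hadj
  · simp at hab
  · simp at hab
  · have h := SimpleGraph.isAcyclic_iff_forall_adj_isBridge.1 hH
      (SimpleGraph.sum_adj_inr.1 hab)
    rw [SimpleGraph.isBridge_iff] at h ⊢
    intro hr
    apply h
    obtain ⟨w⟩ := hr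
    suffices ∀ x y, ((G ⊕g H).deleteEdges {s(Sum.inr a, Sum.inr b)}).Walk x y → ∀ c d, x = .inr c →
        y = .inr d → (H.deleteEdges {s(a, b)}).Reachable c d from this _ _ w a b rfl rfl
    intro x y w
    induction w with
    | nil => rintro c d rfl h; cases h; rfl
    | @cons u v y hadj w ih =>
      rintro c d rfl rfl
      rcases v with v | v
      · simp [SimpleGraph.deleteEdges_adj] at hadj
      · refine SimpleGraph.Reachable.trans (SimpleGraph.Adj.reachable ?_) (ih v d rfl rfl)
        simpa [SimpleGraph.deleteEdges_adj] using hadj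

theorem isTree_sum_sup_edge {V W : Type*} {G : SimpleGraph V} {H : SimpleGraph W} (hG : G.IsTree)
    (hH : H.IsTree) (v : V) (w : W) :
    ((G ⊕g H) ⊔ SimpleGraph.edge (Sum.inl v) (Sum.inr w)).IsTree :=
  ⟨hG.1.sum_sup_edge hH.1, (isAcyclic_sum hG.2 hH.2).sup_edge_of_not_reachable
    (SimpleGraph.not_reachable_sum_inl_inr v w)⟩

/-- A rooted tree each of whose nodes carries `n` slots for vertices, with constraints on the
assignments of vertices to slots. -/
structure Net (n : ℕ) where
  /-- The nodes. -/
  node : Type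
  /-- The tree on the nodes. -/
  tree : SimpleGraph node
  /-- The root. -/
  root : node
  /-- Pairs of slots that have to agree. -/
  same : node × Fin n → node × Fin n → Prop
  /-- Pairs of slots that have to be adjacent. -/
  edge : node × Fin n → node × Fin n → Prop
  /-- Slots that must not be empty. -/
  full : node × Fin n → Prop
  finite : Finite node
  isTree : tree.IsTree
  adj_of_same : ∀ x y, same x y → x.1 = y.1 ∨ tree.Adj x.1 y.1
  eq_of_edge : ∀ x y, edge x y → x.1 = y.1
  bound : ∀ x, ∃ y, Relation.EqvGen same x y ∧ (full y ∨ y.1 = root)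

namespace Net

variable {n : ℕ}

/-- The assignments that satisfy all constraints. -/
def Sat (N : Net n) {V : Type*} (G : SimpleGraph V) (h : N.node × Fin n → Option V) : Prop :=
  (∀ x y, N.same x y → h x = h y) ∧
  (∀ x y, N.edge x y → ∃ a b, h x = some a ∧ h y = some b ∧ G.Adj a b) ∧
  ∀ x, N.full x → h x ≠ none

/-- The number of satisfying assignments with prescribed values at the root. -/
noncomputable def count (N : Net n) {V : Type*} (G : SimpleGraph V) (s : Fin n → Option V) : ℕ :=
  Nat.card {h // N.Sat G h ∧ ∀ i, h (N.root, i) = s i}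

/-- A net with one node. -/
def single (same edge : Fin n → Fin n → Prop) (full : Fin n → Prop) : Net n where
  node := Unit
  tree := ⊥
  root := ()
  same x y := same x.2 y.2
  edge x y := edge x.2 y.2
  full x := full x.2
  finite := inferInstance
  isTree := .of_subsingleton
  adj_of_same _ _ _ := .inl rfl
  eq_of_edge _ _ _ := rfl
  bound x := ⟨x, .refl x, .inr rfl⟩

theorem count_single (same edge : Fin n → Fin n → Prop) (full : Fin n → Prop) {V : Type*}
    (G : SimpleGraph V) (s : Fin n → Option V) : (single same edge full).count G s =
      iverson ((∀ i j, same i j → s i = s j) ∧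
        (∀ i j, edge i j → ∃ a b, s i = some a ∧ s j = some b ∧ G.Adj a b) ∧
        ∀ i, full i → s i ≠ none) := by
  have aux : ∀ h : Unit × Fin n → Option V, (∀ i, h ((), i) = s i) → h = fun x => s x.2 := by
    intro h hs
    ext1 ⟨_, i⟩
    exact hs i
  by_cases hP : (∀ i j, same i j → s i = s j) ∧
        (∀ i j, edge i j → ∃ a b, s i = some a ∧ s j = some b ∧ G.Adj a b) ∧
        ∀ i, full i → s i ≠ none
  · rw [iverson_of hP]
    refine Nat.card_eq_one_iff_unique.2 ⟨⟨?_⟩, ⟨⟨fun x => s x.2, ⟨?_, ?_, ?_⟩, ?_⟩⟩⟩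
    · rintro ⟨h, _, h1⟩ ⟨h', _, h2⟩
      exact Subtype.ext ((aux h h1).trans (aux h' h2).symm)
    · exact fun x y hxy => hP.1 _ _ hxy
    · exact fun x y hxy => hP.2.1 _ _ hxy
    · exact fun x hx => hP.2.2 _ hx
    · exact fun i => rfl
  · rw [iverson_of_not hP]
    refine Nat.card_eq_zero.2 (.inl ⟨?_⟩)
    rintro ⟨h, ⟨h1, h2, h3⟩, h4⟩
    obtain rfl := aux h h4
    exact hP ⟨fun i j hij => h1 ((), i) ((), j) hij, fun i j hij => h2 ((), i) ((), j) hij,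
      fun i hi => h3 ((), i) hi⟩

/-- The constraints on pairs of slots of two nets. -/
def sumRel {A B : Type*} (r : A × Fin n → A × Fin n → Prop) (r' : B × Fin n → B × Fin n → Prop) :
    (A ⊕ B) × Fin n → (A ⊕ B) × Fin n → Prop
  | (.inl a, i), (.inl b, j) => r (a, i) (b, j)
  | (.inr a, i), (.inr b, j) => r' (a, i) (b, j)
  | _, _ => False

/-- Two nets joined by an edge between their roots. The slots of the roots with index in `J`
have to agree, the slots of the second root with index outside `J` must not be empty. -/
def join (M N : Net n) (J : Set (Fin n)) : Net n where
  node := M.node ⊕ N.node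
  tree := (M.tree ⊕g N.tree) ⊔ SimpleGraph.edge (Sum.inl M.root) (Sum.inr N.root)
  root := .inl M.root
  same x y := sumRel M.same N.same x y ∨
    ∃ i ∈ J, x = (.inl M.root, i) ∧ y = (.inr N.root, i)
  edge := sumRel M.edge N.edge
  full
  | (.inl a, i) => M.full (a, i)
  | (.inr a, i) => N.full (a, i) ∨ (a = N.root ∧ i ∉ J)
  finite := by
    have := M.finite
    have := N.finite
    infer_instance
  isTree := isTree_sum_sup_edge M.isTree N.isTree _ _
  adj_of_same := by
    rintro ⟨a | a, i⟩ ⟨b | b, j⟩ (h | ⟨i', _, h1, h2⟩)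
    · refine (M.adj_of_same _ _ h).imp (congrArg Sum.inl) fun h => ?_
      exact Or.inl (SimpleGraph.sum_adj_inl.2 h)
    · simp at h2
    · simp [sumRel] at h
    · cases h1
      cases h2
      exact .inr (.inr (by simp [SimpleGraph.edge_adj]))
    · simp [sumRel] at h
    · simp at h1
    · refine (N.adj_of_same _ _ h).imp (congrArg Sum.inr) fun h => ?_
      exact Or.inl (SimpleGraph.sum_adj_inr.2 h)
    · simp at h1
  eq_of_edge := by
    rintro ⟨a | a, i⟩ ⟨b | b, j⟩ h
    · exact congrArg Sum.inl (M.eq_of_edge _ _ h)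
    · simp [sumRel] at h
    · simp [sumRel] at h
    · exact congrArg Sum.inr (N.eq_of_edge _ _ h)
  bound := by
    have hl : ∀ x y, Relation.EqvGen M.same x y → Relation.EqvGen (fun x y =>
        sumRel M.same N.same x y ∨ ∃ i ∈ J, x = (.inl M.root, i) ∧ y = (.inr N.root, i))
        (.inl x.1, x.2) (.inl y.1, y.2) := by
      intro x y h
      induction h with
      | rel x y h => exact .rel _ _ (.inl h)
      | refl x => exact .refl _
      | symm x y _ ih => exact .symm _ _ ih
      | trans x y z _ _ ih1 ih2 => exact .trans _ _ _ ih1 ih2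
    have hr : ∀ x y, Relation.EqvGen N.same x y → Relation.EqvGen (fun x y =>
        sumRel M.same N.same x y ∨ ∃ i ∈ J, x = (.inl M.root, i) ∧ y = (.inr N.root, i))
        (.inr x.1, x.2) (.inr y.1, y.2) := by
      intro x y h
      induction h with
      | rel x y h => exact .rel _ _ (.inl h)
      | refl x => exact .refl _
      | symm x y _ ih => exact .symm _ _ ih
      | trans x y z _ _ ih1 ih2 => exact .trans _ _ _ ih1 ih2
    rintro ⟨a | a, i⟩
    · obtain ⟨y, h1, h2⟩ := M.bound (a, i)
      exact ⟨_, hl _ _ h1, h2.imp id (congrArg Sum.inl)⟩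
    · obtain ⟨⟨b, j⟩, h1, h2 | rfl⟩ := N.bound (a, i)
      · exact ⟨_, hr _ _ h1, .inl (.inl h2)⟩
      · by_cases hj : j ∈ J
        · exact ⟨(.inl M.root, j), .trans _ _ _ (hr _ _ h1)
            (.symm _ _ (.rel _ _ (.inr ⟨j, hj, rfl, rfl⟩))), .inr rfl⟩
        · exact ⟨_, hr _ _ h1, .inl (.inr ⟨rfl, hj⟩)⟩

theorem sat_join_iff (M N : Net n) (J : Set (Fin n)) {V : Type*} (G : SimpleGraph V)
    (h : (M.node ⊕ N.node) × Fin n → Option V) : (join M N J).Sat G h ↔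
      M.Sat G (fun x => h (.inl x.1, x.2)) ∧ N.Sat G (fun x => h (.inr x.1, x.2)) ∧
      (∀ i ∈ J, h (.inl M.root, i) = h (.inr N.root, i)) ∧
      ∀ i ∉ J, h (.inr N.root, i) ≠ none := by
  constructor
  · rintro ⟨h1, h2, h3⟩
    refine ⟨⟨?_, ?_, ?_⟩, ⟨?_, ?_, ?_⟩, ?_, ?_⟩
    · exact fun x y hxy => h1 (.inl x.1, x.2) (.inl y.1, y.2) (.inl hxy)
    · exact fun x y hxy => h2 (.inl x.1, x.2) (.inl y.1, y.2) hxy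
    · exact fun x hx => h3 (.inl x.1, x.2) hx
    · exact fun x y hxy => h1 (.inr x.1, x.2) (.inr y.1, y.2) (.inl hxy)
    · exact fun x y hxy => h2 (.inr x.1, x.2) (.inr y.1, y.2) hxy
    · exact fun x hx => h3 (.inr x.1, x.2) (.inl hx)
    · exact fun i hi => h1 _ _ (.inr ⟨i, hi, rfl, rfl⟩)
    · exact fun i hi => h3 (.inr N.root, i) (.inr ⟨rfl, hi⟩)
  · rintro ⟨⟨h1, h2, h3⟩, ⟨h4, h5, h6⟩, h7, h8⟩
    refine ⟨?_, ?_, ?_⟩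
    · rintro x y (hxy | ⟨i, hi, rfl, rfl⟩)
      · obtain ⟨a | a, i⟩ := x <;> obtain ⟨b | b, j⟩ := y
        · exact h1 _ _ hxy
        · exact hxy.elim
        · exact hxy.elim
        · exact h4 _ _ hxy
      · exact h7 i hi
    · rintro ⟨a | a, i⟩ ⟨b | b, j⟩ hxy
      · exact h2 _ _ hxy
      · exact hxy.elim
      · exact hxy.elim
      · exact h5 _ _ hxy
    · rintro ⟨a | a, i⟩ hx
      · exact h3 _ hx
      · obtain hx | ⟨rfl, hi⟩ := hx
        · exact h6 _ hx
        · exact h8 _ hi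

theorem count_join (M N : Net n) (J : Set (Fin n)) {V : Type*} (G : SimpleGraph V)
    (s : Fin n → Option V) : (join M N J).count G s = M.count G s *
      Nat.card {h // N.Sat G h ∧ (∀ i ∈ J, h (N.root, i) = s i) ∧
        ∀ i ∉ J, h (N.root, i) ≠ none} := by
  unfold count
  rw [← Nat.card_prod]
  refine Nat.card_congr
    { toFun h := (⟨fun x => h.1 (.inl x.1, x.2), ?_, ?_⟩, ⟨fun x => h.1 (.inr x.1, x.2), ?_, ?_, ?_⟩)
      invFun q := ⟨fun x => Sum.casesOn x.1 (fun a => q.1.1 (a, x.2)) fun a => q.2.1 (a, x.2), ?_⟩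
      left_inv := ?_
      right_inv := ?_ }
  · exact ((sat_join_iff M N J G h.1).1 h.2.1).1
  · exact h.2.2
  · exact ((sat_join_iff M N J G h.1).1 h.2.1).2.1
  · exact fun i hi => (((sat_join_iff M N J G h.1).1 h.2.1).2.2.1 i hi).symm.trans (h.2.2 i)
  · exact ((sat_join_iff M N J G h.1).1 h.2.1).2.2.2
  · refine ⟨(sat_join_iff M N J G _).2 ⟨q.1.2.1, q.2.2.1, ?_, q.2.2.2.2⟩, q.1.2.2⟩
    exact fun i hi => (q.1.2.2 i).trans (q.2.2.2.1 i hi).symm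
  · rintro ⟨h, _⟩
    refine Subtype.ext (funext ?_)
    rintro ⟨a | a, i⟩ <;> rfl
  · rintro ⟨⟨h, _⟩, ⟨h', _⟩⟩
    rfl

theorem count_join_univ (M N : Net n) {V : Type*} (G : SimpleGraph V) (s : Fin n → Option V) :
    (join M N Set.univ).count G s = M.count G s * N.count G s := by
  rw [count_join]
  simp [count]

theorem card_bind (N : Net n) (i : Fin n) {V : Type*} [Fintype V] (G : SimpleGraph V)
    (s : Fin n → Option V) :
    Nat.card {h // N.Sat G h ∧ (∀ j ∈ ({i}ᶜ : Set (Fin n)), h (N.root, j) = s j) ∧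
        ∀ j ∉ ({i}ᶜ : Set (Fin n)), h (N.root, j) ≠ none} =
      ∑ a, N.count G (Function.update s i (some a)) := by
  have := N.finite
  unfold count
  rw [← Nat.card_sigma]
  refine Nat.card_congr
    { toFun h := ⟨(h.1 (N.root, i)).get ?_, ⟨h.1, h.2.1, ?_⟩⟩
      invFun q := ⟨q.2.1, q.2.2.1, ?_, ?_⟩
      left_inv := ?_
      right_inv := ?_ }
  · exact Option.isSome_iff_ne_none.2 (h.2.2.2 i (by simp))
  · intro j
    by_cases hj : j = i
    · subst hj
      simp
    · rw [Function.update_of_ne hj, h.2.2.1 j hj]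
  · intro j hj
    rw [q.2.2.2 j, Function.update_of_ne hj]
  · intro j hj
    obtain rfl : j = i := by simpa using hj
    rw [q.2.2.2 j]
    simp
  · rintro ⟨h, _⟩
    rfl
  · rintro ⟨a, h, h1, h2⟩
    have ha : h (N.root, i) = some a := by simpa using h2 i
    have key : ∀ a' (_ : a' = a) h3, (⟨a', h, h1, h3⟩ : Σ a, {h // N.Sat G h ∧
        ∀ j, h (N.root, j) = Function.update s i (some a) j}) = ⟨a, h, h1, h2⟩ := by
      rintro _ rfl _
      rfl
    exact key _ (by simp [ha]) (by simpa [ha] using h2)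

end Net

/-- The net of a term. -/
def Term.net {n : ℕ} : Term (Fin n) → Net n
  | one => .single (fun _ _ => False) (fun _ _ => False) fun _ => False
  | eq x y => .single (fun i j => i = x ∧ j = y) (fun _ _ => False) fun i => i = x
  | edge x y => .single (fun _ _ => False) (fun i j => i = x ∧ j = y) fun _ => False
  | mul t u => .join t.net u.net Set.univ
  | sum x t => .join (.single (fun _ _ => False) (fun _ _ => False) fun _ => False) t.net {x}ᶜ

theorem Term.count_net {n : ℕ} {V : Type*} [Fintype V] (G : SimpleGraph V) (t : Term (Fin n)) :
    ∀ s, t.net.count G s = t.eval G s := by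
  induction t with
  | one => intro s; simp [net, Net.count_single, eval, iverson]
  | eq x y =>
    intro s
    rw [net, Net.count_single, eval]
    congr 1
    apply propext
    constructor
    · rintro ⟨h1, -, h2⟩
      obtain ⟨a, ha⟩ := Option.ne_none_iff_exists'.1 (h2 x rfl)
      exact ⟨a, ha, h1 x y ⟨rfl, rfl⟩ ▸ ha⟩
    · rintro ⟨a, h1, h2⟩
      refine ⟨?_, by simp, ?_⟩
      · rintro _ _ ⟨rfl, rfl⟩
        rw [h1, h2]
      · rintro _ rfl
        simp [h1]
  | edge x y =>
    intro s
    rw [net, Net.count_single, eval]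
    congr 1
    simp
  | mul t u iht ihu =>
    intro s
    rw [net, Net.count_join_univ, iht, ihu, eval]
  | sum x t ih =>
    intro s
    rw [net, Net.count_join, Net.card_bind, eval]
    simp [ih, Net.count_single, iverson]

theorem treewidth_le {U T : Type} [Fintype T] {F : SimpleGraph U} (D : TreeDecomposition F T) :
    treewidth F ≤ D.width := by
  refine csInf_le ⟨-1, ?_⟩ ⟨T, _, D, rfl⟩
  rintro w ⟨T, _, D, rfl⟩
  simp only [TreeDecomposition.width]
  omega

namespace Net

variable {n : ℕ} (N : Net n)

/-- The classes of slots that have to agree with each other. -/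
abbrev Slot : Type := Quot N.same

/-- The classes of slots that do not meet the root. -/
abbrev Vertex : Type := {c : N.Slot // ∀ i, c ≠ Quot.mk _ (N.root, i)}

/-- The graph on the classes of slots that do not meet the root. -/
def graph : SimpleGraph N.Vertex where
  Adj c d := c ≠ d ∧ ∃ x y, Quot.mk _ x = c.1 ∧ Quot.mk _ y = d.1 ∧ (N.edge x y ∨ N.edge y x)
  symm := ⟨by
    rintro c d ⟨h, x, y, h1, h2, h3⟩
    exact ⟨h.symm, y, x, h2, h1, h3.symm⟩⟩
  loopless := ⟨fun c h => h.1 rfl⟩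

instance : Finite N.Vertex := by
  have := N.finite
  have : Finite N.Slot := Finite.of_surjective _ Quot.mk_surjective
  infer_instance

open Classical in
/-- The tree decomposition of the graph of a net. -/
noncomputable def decomposition : TreeDecomposition N.graph N.node where
  tree := N.tree
  isTree := N.isTree
  bag t := Set.Finite.toFinset (s := {c | ∃ i, Quot.mk _ (t, i) = c.1}) (Set.toFinite _)
  cover_vertex := by
    rintro ⟨c, hc⟩
    obtain ⟨⟨t, i⟩, rfl⟩ := Quot.mk_surjective c
    exact ⟨t, by simp⟩
  cover_edge := by
    rintro c d ⟨-, ⟨t, i⟩, ⟨u, j⟩, h1, h2, h3⟩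
    have : t = u := h3.elim (N.eq_of_edge _ _) fun h => (N.eq_of_edge _ _ h).symm
    subst this
    refine ⟨t, ?_, ?_⟩ <;> simp
    · exact ⟨i, h1⟩
    · exact ⟨j, h2⟩
  connected := by
    intro c
    have key : ∀ x y, Relation.EqvGen N.same x y → ∀ (hx : Quot.mk _ x = c.1)
        (hy : Quot.mk _ y = c.1), (N.tree.induce {t | ∃ i, Quot.mk N.same (t, i) = c.1}).Reachable
          ⟨x.1, x.2, hx⟩ ⟨y.1, y.2, hy⟩ := by
      intro x y h
      induction h with
      | rel x y h =>
        intro hx hy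
        rcases N.adj_of_same x y h with h | h
        · simp only [h]
          rfl
        · exact SimpleGraph.Adj.reachable h
      | refl x => intro _ _; rfl
      | symm x y _ ih => exact fun hx hy => (ih hy hx).symm
      | trans x y z h _ ih1 ih2 =>
        intro hx hz
        have hy := (Quot.eqvGen_sound h).symm.trans hx
        exact (ih1 hx hy).trans (ih2 hy hz)
    have hset : {t | c ∈ Set.Finite.toFinset (s := {c : N.Vertex | ∃ i, Quot.mk _ (t, i) = c.1})
        (Set.toFinite _)} = {t | ∃ i, Quot.mk N.same (t, i) = c.1} := by
      ext t
      simp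
    rw [hset]
    rw [SimpleGraph.connected_iff]
    refine ⟨?_, ?_⟩
    · rintro ⟨t, i, hi⟩ ⟨u, j, hj⟩
      exact key (t, i) (u, j) (Quot.eqvGen_exact (hi.trans hj.symm)) hi hj
    · obtain ⟨⟨t, i⟩, h⟩ := Quot.mk_surjective c.1
      exact ⟨⟨t, i, h⟩⟩

theorem card_bag_le (t : N.node) : (N.decomposition.bag t).card ≤ n := by
  classical
  have h : ∀ c ∈ N.decomposition.bag t, ∃ i, Quot.mk N.same (t, i) = c.1 := by
    intro c hc
    simpa [decomposition] using hc
  choose f hf using h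
  have := Fintype.card_le_of_injective (fun c : N.decomposition.bag t => f c.1 c.2) (by
    intro c d hcd
    refine Subtype.ext (Subtype.ext ?_)
    rw [← hf c.1 c.2, ← hf d.1 d.2]
    exact congrArg (fun i => Quot.mk N.same (t, i)) hcd)
  simpa using this

theorem treewidth_graph_le {k : ℕ} (N : Net (k + 1)) : treewidth N.graph ≤ k := by
  have := N.finite
  have := Fintype.ofFinite N.node
  refine (treewidth_le N.decomposition).trans ?_
  have : (Finset.univ.sup fun t => (N.decomposition.bag t).card) ≤ k + 1 :=
    Finset.sup_le fun t _ => N.card_bag_le t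
  simp only [TreeDecomposition.width]
  omega

/-- A net whose constraints contradict each other if the slots at the root are empty. -/
def Bad : Prop :=
  (∃ x i, Quot.mk N.same x = Quot.mk N.same (N.root, i) ∧
    (N.full x ∨ ∃ y, N.edge x y ∨ N.edge y x)) ∨
  ∃ x y, Quot.mk N.same x = Quot.mk N.same y ∧ N.edge x y

variable {N}

theorem Sat.eq_of_mk_eq {V : Type*} {G : SimpleGraph V} {h : N.node × Fin n → Option V}
    (hs : N.Sat G h) {x y : N.node × Fin n} (hxy : Quot.mk N.same x = Quot.mk N.same y) :
    h x = h y :=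
  congrArg (Quot.lift h hs.1) hxy

theorem Sat.ne_none {V : Type*} {G : SimpleGraph V} {h : N.node × Fin n → Option V}
    (hs : N.Sat G h) {x : N.node × Fin n}
    (hx : ∀ i, Quot.mk N.same x ≠ Quot.mk N.same (N.root, i)) : h x ≠ none := by
  obtain ⟨⟨t, i⟩, h1, h2 | rfl⟩ := N.bound x
  · rw [hs.eq_of_mk_eq (Quot.eqvGen_sound h1)]
    exact hs.2.2 _ h2
  · exact (hx i (Quot.eqvGen_sound h1)).elim

theorem count_eq_zero_of_bad (hN : N.Bad) {V : Type*} (G : SimpleGraph V) :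
    N.count G (fun _ => none) = 0 := by
  refine Nat.card_eq_zero.2 (.inl ⟨?_⟩)
  rintro ⟨h, hs, h0⟩
  rcases hN with ⟨x, i, h1, h2 | ⟨y, h2 | h2⟩⟩ | ⟨x, y, h1, h2⟩
  · exact hs.2.2 x h2 ((hs.eq_of_mk_eq h1).trans (h0 i))
  · obtain ⟨a, b, h3, h4, h5⟩ := hs.2.1 _ _ h2
    rw [hs.eq_of_mk_eq h1, h0 i] at h3
    simp at h3
  · obtain ⟨a, b, h3, h4, h5⟩ := hs.2.1 _ _ h2
    rw [hs.eq_of_mk_eq h1, h0 i] at h4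
    simp at h4
  · obtain ⟨a, b, h3, h4, h5⟩ := hs.2.1 _ _ h2
    rw [hs.eq_of_mk_eq h1, h4] at h3
    cases h3
    exact G.loopless.irrefl _ h5

open Classical in
theorem count_eq_hom (hN : ¬ N.Bad) {V : Type*} (G : SimpleGraph V) :
    N.count G (fun _ => none) = hom N.graph G := by
  have hroot : ∀ x y, N.edge x y ∨ N.edge y x →
      ∀ i, Quot.mk N.same x ≠ Quot.mk N.same (N.root, i) :=
    fun x y hxy i h => hN (.inl ⟨x, i, h, .inr ⟨y, hxy⟩⟩)
  let val (f : N.graph →g G) (c : N.Slot) : Option V :=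
    if hc : ∀ i, c ≠ Quot.mk _ (N.root, i) then some (f ⟨c, hc⟩) else none
  have hval : ∀ f c (hc : ∀ i, c ≠ Quot.mk _ (N.root, i)), val f c = some (f ⟨c, hc⟩) :=
    fun f c hc => dif_pos hc
  have hval' : ∀ f i, val f (Quot.mk _ (N.root, i)) = none :=
    fun f i => dif_neg fun h => h i rfl
  have hsat : ∀ f, N.Sat G fun x => val f (Quot.mk _ x) := by
    intro f
    refine ⟨fun x y hxy => congrArg (val f) (Quot.sound hxy), fun x y hxy => ?_, fun x hx => ?_⟩
    · have hx := hroot x y (.inl hxy)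
      have hy := hroot y x (.inr hxy)
      refine ⟨_, _, hval f _ hx, hval f _ hy, f.map_rel ⟨fun h => ?_, x, y, rfl, rfl, .inl hxy⟩⟩
      exact hN (.inr ⟨x, y, congrArg Subtype.val h, hxy⟩)
    · show val f (Quot.mk _ x) ≠ none
      rw [hval f _ fun i h => hN (.inl ⟨x, i, h, .inl hx⟩)]
      simp
  refine (Nat.card_eq_of_bijective (fun f : N.graph →g G =>
    (⟨fun x => val f (Quot.mk _ x), hsat f, hval' f⟩ :
      {h // N.Sat G h ∧ ∀ i, h (N.root, i) = none})) ⟨?_, ?_⟩).symm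
  · intro f g hfg
    ext ⟨c, hc⟩
    obtain ⟨x, rfl⟩ := Quot.mk_surjective c
    have := congrFun (congrArg Subtype.val hfg) x
    simpa [hval _ _ hc] using this
  · rintro ⟨h, hs, h0⟩
    have hsome : ∀ c : N.Vertex, ∃ a, Quot.lift h hs.1 c.1 = some a := by
      rintro ⟨c, hc⟩
      obtain ⟨x, rfl⟩ := Quot.mk_surjective c
      exact Option.ne_none_iff_exists'.1 (hs.ne_none hc)
    choose f hf using hsome
    refine ⟨⟨f, ?_⟩, Subtype.ext (funext fun x => ?_)⟩
    · rintro c d ⟨-, x, y, hx, hy, hxy⟩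
      have h1 : h x = some (f c) := by rw [← hf, ← hx]
      have h2 : h y = some (f d) := by rw [← hf, ← hy]
      rcases hxy with hxy | hxy
      · obtain ⟨a, b, h3, h4, h5⟩ := hs.2.1 _ _ hxy
        simp_all
      · obtain ⟨a, b, h3, h4, h5⟩ := hs.2.1 _ _ hxy
        simp_all [G.adj_comm]
    · by_cases hx : ∀ i, Quot.mk N.same x ≠ Quot.mk N.same (N.root, i)
      · simp only [hval _ _ hx]
        exact (hf ⟨_, hx⟩).symm
      · push Not at hx
        obtain ⟨i, hi⟩ := hx
        simp only [hi, hval']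
        rw [hs.eq_of_mk_eq hi]
        exact (h0 i).symm

end Net

theorem Term.eval_eq_of_homIndistinguishable {k m : ℕ} {V W : Type*} [Fintype V] [Fintype W]
    {G : SimpleGraph V} {H : SimpleGraph W} (h : HomIndistinguishableTW m k G H)
    (t : Term (Fin (k + 1))) :
    (t.eval G (fun _ => none) : ZMod m) = t.eval H fun _ => none := by
  rw [← t.count_net G, ← t.count_net H]
  by_cases hN : t.net.Bad
  · rw [Net.count_eq_zero_of_bad hN, Net.count_eq_zero_of_bad hN]
  · rw [Net.count_eq_hom hN, Net.count_eq_hom hN, ZMod.natCast_eq_natCast_iff]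
    exact h _ _ t.net.treewidth_graph_le

namespace Term

/-- Renaming of variables. -/
def map {α β : Type*} (f : α → β) : Term α → Term β
  | one => one
  | eq x y => eq (f x) (f y)
  | edge x y => edge (f x) (f y)
  | mul t u => mul (t.map f) (u.map f)
  | sum x t => sum (f x) (t.map f)

/-- Renaming along `f` does not capture variables. -/
def CaptureFree {α β : Type*} (f : α → β) : Term α → Prop
  | one => True
  | eq _ _ => True
  | edge _ _ => True
  | mul t u => t.CaptureFree f ∧ u.CaptureFree f
  | sum x t => t.CaptureFree f ∧ ∀ y ∈ t.freeVars, f y = f x → y = x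

theorem freeVars_map_subset {α β : Type*} (f : α → β) (t : Term α) :
    (t.map f).freeVars ⊆ f '' t.freeVars := by
  induction t with
  | one => simp [map, freeVars]
  | eq x y => simp [map, freeVars, Set.image_pair]
  | edge x y => simp [map, freeVars, Set.image_pair]
  | mul t u iht ihu =>
    simp only [map, freeVars, Set.image_union]
    exact Set.union_subset_union iht ihu
  | sum x t ih =>
    rintro _ ⟨hy, hyx⟩
    obtain ⟨y, hy', rfl⟩ := ih hy
    exact ⟨y, ⟨hy', fun h => hyx (congrArg f h)⟩, rfl⟩

theorem eval_map {α β : Type*} [DecidableEq α] [DecidableEq β] (f : α → β) {V : Type*} [Fintype V]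
    (G : SimpleGraph V) (t : Term α) (ht : t.CaptureFree f) :
    ∀ s : β → Option V, (t.map f).eval G s = t.eval G (s ∘ f) := by
  induction t with
  | one => intro s; rfl
  | eq x y => intro s; rfl
  | edge x y => intro s; rfl
  | mul t u iht ihu => intro s; simp only [map, eval, iht ht.1, ihu ht.2]
  | sum x t ih =>
    intro s
    refine Finset.sum_congr rfl fun a _ => ?_
    rw [ih ht.1]
    refine eval_congr G t _ _ fun y hy => ?_
    by_cases hyx : y = x
    · subst hyx
      simp
    · have : f y ≠ f x := fun h => hyx (ht.2 y hy h)
      simp [Function.update_of_ne hyx, Function.update_of_ne this]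

/-- Product of a list of terms. -/
def prodList {α : Type*} : List (Term α) → Term α
  | [] => one
  | t :: l => mul t (prodList l)

theorem freeVars_prodList_subset {α : Type*} {X : Set α} (l : List (Term α))
    (h : ∀ t ∈ l, t.freeVars ⊆ X) : (prodList l).freeVars ⊆ X := by
  induction l with
  | nil => simp [prodList, freeVars]
  | cons t l ih =>
    exact Set.union_subset (h t (by simp)) (ih fun u hu => h u (by simp [hu]))

theorem captureFree_prodList {α β : Type*} {f : α → β} (l : List (Term α))
    (h : ∀ t ∈ l, t.CaptureFree f) : (prodList l).CaptureFree f := by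
  induction l with
  | nil => trivial
  | cons t l ih => exact ⟨h t (by simp), ih fun u hu => h u (by simp [hu])⟩

theorem eval_prodList {α : Type*} [DecidableEq α] {V : Type*} [Fintype V] (G : SimpleGraph V)
    (l : List (Term α)) (s : α → Option V) :
    (prodList l).eval G s = (l.map fun t => t.eval G s).prod := by
  induction l with
  | nil => rfl
  | cons t l ih => simp [prodList, eval, ih]

/-- Summation over a list of variables. -/
def sumList {α : Type*} : List α → Term α → Term α
  | [], t => t
  | x :: l, t => sum x (sumList l t)

theorem freeVars_sumList {α : Type*} (l : List α) (t : Term α) :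
    (sumList l t).freeVars = t.freeVars \ {x | x ∈ l} := by
  induction l with
  | nil => simp [sumList]
  | cons x l ih =>
    ext y
    simp [sumList, freeVars, ih]
    tauto

theorem captureFree_sumList {α β : Type*} {f : α → β} {X : Set α} (hf : Set.InjOn f X)
    (l : List α) (hl : ∀ x ∈ l, x ∈ X) (t : Term α) (ht : t.freeVars ⊆ X)
    (ht' : t.CaptureFree f) : (sumList l t).CaptureFree f := by
  induction l with
  | nil => exact ht'
  | cons x l ih =>
    refine ⟨ih fun y hy => hl y (by simp [hy]), fun y hy hyx => ?_⟩
    rw [freeVars_sumList] at hy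
    exact hf (ht hy.1) (hl x (by simp)) hyx

end Term

/-- The sum of the values of `f` over all ways to assign new values to the variables in a list. -/
def sumOver {α : Type*} [DecidableEq α] {V : Type*} [Fintype V] :
    List α → ((α → Option V) → ℕ) → (α → Option V) → ℕ
  | [], f, s => f s
  | x :: l, f, s => ∑ a, sumOver l f (Function.update s x (some a))

section sumOver

variable {α : Type*} [DecidableEq α] {V : Type*} [Fintype V]

theorem Term.eval_sumList (G : SimpleGraph V) (l : List α) (t : Term α) :
    ∀ s, (sumList l t).eval G s = sumOver l (t.eval G) s := by
  induction l with
  | nil => intro s; rfl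
  | cons x l ih => intro s; simp only [sumList, eval, ih, sumOver]

theorem sumOver_append (l l' : List α) (f : (α → Option V) → ℕ) :
    ∀ s, sumOver (l ++ l') f s = sumOver l (sumOver l' f) s := by
  induction l with
  | nil => intro s; rfl
  | cons x l ih => intro s; simp only [List.cons_append, sumOver, ih]

theorem sumOver_mul (l : List α) (f g : (α → Option V) → ℕ)
    (hg : ∀ s s', (∀ x ∉ l, s x = s' x) → g s = g s') :
    ∀ s, sumOver l (fun s => f s * g s) s = sumOver l f s * g s := by
  induction l with
  | nil => intro s; rfl
  | cons x l ih =>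
    intro s
    simp only [sumOver]
    rw [Finset.sum_mul]
    refine Finset.sum_congr rfl fun a _ => ?_
    rw [ih fun s s' h => hg s s' fun y hy => h y fun h' => hy (List.mem_cons_of_mem _ h')]
    congr 1
    refine hg _ _ fun y hy => ?_
    rw [Function.update_of_ne]
    rintro rfl
    exact hy (by simp)

open Classical in
theorem sumOver_eq_sum_filter [Fintype α] (l : List α) (hl : l.Nodup) (f : (α → Option V) → ℕ) :
    ∀ s, sumOver l f s = ∑ g ∈ Finset.univ.filter fun g : α → Option V =>
      (∀ x ∉ l, g x = s x) ∧ ∀ x ∈ l, g x ≠ none, f g := by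
  induction l with
  | nil =>
    intro s
    have : (Finset.univ.filter fun g : α → Option V =>
        (∀ x ∉ ([] : List α), g x = s x) ∧ ∀ x ∈ ([] : List α), g x ≠ none) = {s} := by
      ext g
      simp [funext_iff]
    rw [this, Finset.sum_singleton]
    rfl
  | cons x l ih =>
    intro s
    rw [List.nodup_cons] at hl
    simp only [sumOver, ih hl.2]
    rw [← Finset.sum_biUnion]
    · refine Finset.sum_congr ?_ fun _ _ => rfl
      ext g
      simp only [Finset.mem_biUnion, Finset.mem_univ, true_and, Finset.mem_filter]
      constructor
      · rintro ⟨a, h1, h2⟩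
        have hx : g x = some a := by simpa using h1 x hl.1
        refine ⟨fun y hy => ?_, fun y hy => ?_⟩
        · rw [List.mem_cons, not_or] at hy
          rw [h1 y hy.2, Function.update_of_ne hy.1]
        · rcases List.mem_cons.1 hy with rfl | hy
          · simp [hx]
          · exact h2 y hy
      · rintro ⟨h1, h2⟩
        obtain ⟨a, ha⟩ := Option.ne_none_iff_exists'.1 (h2 x (by simp))
        refine ⟨a, fun y hy => ?_, fun y hy => h2 y (by simp [hy])⟩
        by_cases hyx : y = x
        · subst hyx
          simp [ha]
        · rw [Function.update_of_ne hyx]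
          exact h1 y (by simp [hy, hyx])
    · intro a _ b _ hab
      rw [Function.onFun, Finset.disjoint_left]
      intro g h1 h2
      simp only [Finset.mem_filter, Finset.mem_univ, true_and] at h1 h2
      have h3 := (h1.1 x hl.1).symm.trans (h2.1 x hl.1)
      simp at h3
      exact hab h3

theorem sumOver_eq_sum [Fintype α] (l : List α) (hl : l.Nodup) (hl' : ∀ x, x ∈ l)
    (f : (α → Option V) → ℕ) (s : α → Option V) :
    sumOver l f s = ∑ g : α → V, f fun x => some (g x) := by
  classical
  rw [sumOver_eq_sum_filter l hl]
  symm
  refine Finset.sum_bij (fun g _ x => some (g x)) ?_ ?_ ?_ ?_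
  · simp [hl']
  · intro g _ g' _ h
    ext x
    simpa using congrFun h x
  · intro g hg
    simp only [Finset.mem_filter, Finset.mem_univ, true_and] at hg
    choose g' hg' using fun x => Option.ne_none_iff_exists'.1 (hg.2 x (hl' x))
    exact ⟨g', by simp, funext fun x => (hg' x).symm⟩
  · simp

end sumOver

section Built

variable {T U : Type*} [DecidableEq T] [DecidableEq U]

/-- A set of bags that arises by successively adding a bag whose intersections with the earlier
bags are contained in one of them. -/
inductive Built (b : T → Finset U) : Finset T → Prop
  | single (t : T) : Built b {t}
  | insert {S : Finset T} {s t : T} (hS : Built b S) (ht : t ∉ S) (hs : s ∈ S)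
      (h : ∀ s' ∈ S, b t ∩ b s' ⊆ b s) : Built b (insert t S)

theorem exists_injOn_extension {n : ℕ} (f : U → Fin n) (B C : Finset U) (hCB : C ⊆ B)
    (hB : B.card ≤ n) (hf : Set.InjOn f C) :
    ∃ g : U → Fin n, Set.InjOn g B ∧ ∀ u ∉ B \ C, g u = f u := by
  have hcard : Fintype.card ↥(B \ C) ≤ Fintype.card ↥(C.image f)ᶜ := by
    rw [Fintype.card_coe, Fintype.card_coe, Finset.card_compl, Finset.card_image_of_injOn hf,
      Fintype.card_fin, Finset.card_sdiff_of_subset hCB]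
    omega
  obtain ⟨e⟩ := Function.Embedding.nonempty_of_card_le hcard
  have he : ∀ u, (e u).1 ∉ C.image f := fun u => Finset.mem_compl.1 (e u).2
  refine ⟨fun u => if h : u ∈ B \ C then (e ⟨u, h⟩).1 else f u, ?_, fun u hu => dif_neg hu⟩
  intro u hu v hv huv
  have hC : ∀ u ∈ B, u ∉ B \ C → u ∈ C := by
    intro u hu h
    by_contra h'
    exact h (Finset.mem_sdiff.2 ⟨hu, h'⟩)
  by_cases h1 : u ∈ B \ C <;> by_cases h2 : v ∈ B \ C
  · simp only [h1, h2, dif_pos] at huv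
    exact congrArg Subtype.val (e.injective (Subtype.ext huv))
  · simp only [h1, h2, dif_pos, dif_neg, not_false_eq_true] at huv
    exact (he ⟨u, h1⟩ (huv ▸ Finset.mem_image_of_mem f (hC v hv h2))).elim
  · simp only [h1, h2, dif_pos, dif_neg, not_false_eq_true] at huv
    exact (he ⟨v, h2⟩ (huv ▸ Finset.mem_image_of_mem f (hC u hu h1))).elim
  · simp only [h1, h2, dif_neg, not_false_eq_true] at huv
    exact hf (hC u hu h1) (hC v hv h2) huv

theorem Built.exists_injOn {b : T → Finset U} {S : Finset T} (hS : Built b S) {n : ℕ} [NeZero n]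
    (hb : ∀ t, (b t).card ≤ n) : ∃ f : U → Fin n, ∀ s ∈ S, Set.InjOn f (b s) := by
  induction hS with
  | single t =>
    obtain ⟨f, hf, -⟩ := exists_injOn_extension (fun _ => (0 : Fin n)) (b t) ∅ (by simp) (hb t)
      (by simp)
    exact ⟨f, by simpa using hf⟩
  | @insert S s t hS ht hs h ih =>
    obtain ⟨f, hf⟩ := ih
    obtain ⟨g, hg1, hg2⟩ := exists_injOn_extension f (b t) (b t ∩ b s) Finset.inter_subset_left
      (hb t) ((hf s hs).mono (by simp))
    refine ⟨g, fun s' hs' => ?_⟩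
    rcases Finset.mem_insert.1 hs' with rfl | hs'
    · exact hg1
    · refine (hf s' hs').congr fun u hu => (hg2 u fun hu' => ?_).symm
      simp only [Finset.mem_sdiff, Finset.mem_inter, not_and] at hu'
      exact hu'.2 hu'.1 (h s' hs' (Finset.mem_inter.2 ⟨hu'.1, hu⟩))

theorem Built.exists_term {b : T → Finset U} {S : Finset T} (hS : Built b S) {β : Type*}
    {f : U → β} (hf : ∀ t, Set.InjOn f (b t)) :
    ∃ l : List U, l.Nodup ∧ (∀ u, u ∈ l ↔ ∃ s ∈ S, u ∈ b s) ∧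
      ∀ τ : T → Term U, (∀ t, (τ t).freeVars ⊆ b t) → (∀ t, (τ t).CaptureFree f) →
        ∃ R : Term U, R.freeVars = ∅ ∧ R.CaptureFree f ∧
          ∀ (V : Type) [Fintype V] (G : SimpleGraph V),
            R.eval G (fun _ => none) = sumOver l (fun s => ∏ t ∈ S, (τ t).eval G s) fun _ => none := by
  induction hS with
  | single t =>
    refine ⟨(b t).toList, Finset.nodup_toList _, by simp, fun τ h1 h2 =>
      ⟨.sumList (b t).toList (τ t), ?_, ?_, fun V _ G => ?_⟩⟩
    · rw [Term.freeVars_sumList]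
      simpa [Set.sdiff_eq_empty] using h1 t
    · exact Term.captureFree_sumList (hf t) _ (by simp) _ (h1 t) (h2 t)
    · simp [Term.eval_sumList]
  | @insert S s t hS ht hs h ih =>
    obtain ⟨l, hl1, hl2, ih⟩ := ih
    have hnew : ∀ u ∈ b t \ b s, ∀ s' ∈ S, u ∉ b s' := fun u hu s' hs' hu' =>
      (Finset.mem_sdiff.1 hu).2 (h s' hs' (Finset.mem_inter.2 ⟨(Finset.mem_sdiff.1 hu).1, hu'⟩))
    refine ⟨l ++ (b t \ b s).toList, ?_, fun u => ?_, fun τ h1 h2 => ?_⟩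
    · refine List.nodup_append'.2 ⟨hl1, Finset.nodup_toList _, fun u hu hu' => ?_⟩
      obtain ⟨s', hs', hu⟩ := (hl2 u).1 hu
      exact hnew u (Finset.mem_toList.1 hu') s' hs' hu
    · rw [List.mem_append, hl2, Finset.mem_toList, Finset.mem_sdiff]
      constructor
      · rintro (⟨s', hs', hu⟩ | ⟨hu, -⟩)
        · exact ⟨s', Finset.mem_insert_of_mem hs', hu⟩
        · exact ⟨t, Finset.mem_insert_self _ _, hu⟩
      · rintro ⟨s', hs', hu⟩
        rcases Finset.mem_insert.1 hs' with rfl | hs'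
        · by_cases hus : u ∈ b s
          · exact .inl ⟨s, hs, hus⟩
          · exact .inr ⟨hu, hus⟩
        · exact .inl ⟨s', hs', hu⟩
    · let σ : Term U := .sumList (b t \ b s).toList (τ t)
      have hσ1 : σ.freeVars ⊆ b s := by
        rw [Term.freeVars_sumList]
        rintro u ⟨hu1, hu2⟩
        by_contra hu3
        exact hu2 (by simpa using ⟨h1 t hu1, hu3⟩)
      have hσ2 : σ.CaptureFree f := Term.captureFree_sumList (hf t) _
        (fun x hx => (Finset.mem_sdiff.1 (Finset.mem_toList.1 hx)).1) _ (h1 t) (h2 t)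
      obtain ⟨R, hR1, hR2, hR3⟩ := ih (Function.update τ s (.mul (τ s) σ)) (by
          intro t'
          by_cases h' : t' = s
          · subst h'
            rw [Function.update_self]
            exact Set.union_subset (h1 t') hσ1
          · simpa [Function.update_of_ne h'] using h1 t') (by
          intro t'
          by_cases h' : t' = s
          · subst h'
            simpa using ⟨h2 t', hσ2⟩
          · simpa [Function.update_of_ne h'] using h2 t')
      refine ⟨R, hR1, hR2, fun V _ G => ?_⟩
      rw [hR3, sumOver_append]
      congr 1
      ext x
      simp only [Finset.prod_insert ht]
      rw [sumOver_mul, ← Term.eval_sumList, ← Finset.mul_prod_erase _ _ hs,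
        ← Finset.mul_prod_erase S (fun t => (τ t).eval G x) hs, Function.update_self]
      · rw [Finset.prod_congr rfl (g := fun t => (τ t).eval G x)]
        · simp only [Term.eval, σ]
          ring
        · intro t' ht'
          rw [Function.update_of_ne (Finset.ne_of_mem_erase ht')]
      · intro x y hxy
        refine Finset.prod_congr rfl fun s' hs' => Term.eval_congr G _ _ _ fun u hu => hxy u ?_
        exact fun hu' => hnew u (Finset.mem_toList.1 hu') s' hs' (h1 s' hu)

theorem TreeDecomposition.built_univ {F : SimpleGraph U} [Fintype T] (D : TreeDecomposition F T) :
    Built D.bag Finset.univ := by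
  have hpath : ∀ m, 1 ≤ m → m ≤ Fintype.card T → ∃ S : Finset T, S.card = m ∧ Built D.bag S ∧
      ∀ x ∈ S, ∀ y ∈ S, ∃ w : D.tree.Walk x y, w.IsPath ∧ ∀ z ∈ w.support, z ∈ S := by
    intro m hm
    induction m, hm using Nat.le_induction with
    | base =>
      intro _
      obtain ⟨t⟩ := D.isTree.1.nonempty
      refine ⟨{t}, by simp, .single t, fun x hx y hy => ?_⟩
      obtain rfl := Finset.mem_singleton.1 hx
      obtain rfl := Finset.mem_singleton.1 hy
      exact ⟨.nil, by simp, by simp⟩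
    | succ m hm ih =>
      intro hm'
      obtain ⟨S, hS1, hS2, hS3⟩ := ih (by omega)
      obtain ⟨s₀, hs₀⟩ : S.Nonempty := Finset.card_pos.1 (by omega)
      obtain ⟨t₀, ht₀⟩ : ∃ t, t ∉ S := by
        by_contra! h
        rw [Finset.eq_univ_iff_forall.2 h, Finset.card_univ] at hS1
        omega
      obtain ⟨w⟩ := D.isTree.1.preconnected s₀ t₀
      obtain ⟨⟨⟨s, t⟩, hst⟩, -, hs, ht⟩ := w.exists_boundary_dart (S : Set T) hs₀ ht₀
      change s ∈ S at hs
      change t ∉ S at ht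
      change D.tree.Adj s t at hst
      have hto : ∀ y ∈ S, ∃ w : D.tree.Walk t y, w.IsPath ∧ s ∈ w.support ∧
          ∀ z ∈ w.support, z ∈ insert t S := by
        intro y hy
        obtain ⟨w, hw1, hw2⟩ := hS3 s hs y hy
        refine ⟨.cons hst.symm w, hw1.cons fun h => ht (hw2 _ h), by simp, fun z hz => ?_⟩
        rw [SimpleGraph.Walk.support_cons, List.mem_cons] at hz
        exact Finset.mem_insert.2 (hz.imp id (hw2 z))
      refine ⟨insert t S, by rw [Finset.card_insert_of_notMem ht, hS1],
        .insert hS2 ht hs fun s' hs' u hu => ?_, fun x hx y hy => ?_⟩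
      · obtain ⟨w, hw1, hw2, -⟩ := hto s' hs'
        obtain ⟨q⟩ := (D.connected u).preconnected ⟨t, (Finset.mem_inter.1 hu).1⟩
          ⟨s', (Finset.mem_inter.1 hu).2⟩
        let q' := q.map (SimpleGraph.Embedding.induce {t | u ∈ D.bag t}).toHom
        have hq : w = q'.bypass := congrArg Subtype.val
          ((D.isTree.2.subsingleton_path _ _).elim ⟨w, hw1⟩ ⟨q'.bypass, q'.bypass_isPath⟩)
        rw [hq] at hw2
        have := q'.support_bypass_subset_support hw2
        rw [SimpleGraph.Walk.support_map, List.mem_map] at this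
        obtain ⟨⟨x, hx⟩, -, rfl⟩ := this
        exact hx
      · rcases Finset.mem_insert.1 hx with rfl | hx' <;>
          rcases Finset.mem_insert.1 hy with rfl | hy'
        · exact ⟨.nil, by simp, by simp⟩
        · obtain ⟨w, hw1, -, hw3⟩ := hto y hy'
          exact ⟨w, hw1, hw3⟩
        · obtain ⟨w, hw1, -, hw3⟩ := hto x hx'
          exact ⟨w.reverse, hw1.reverse, by simpa using hw3⟩
        · obtain ⟨w, hw1, hw2⟩ := hS3 x hx' y hy'
          exact ⟨w, hw1, fun z hz => Finset.mem_insert_of_mem (hw2 z hz)⟩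
  have := D.isTree.1.nonempty
  obtain ⟨S, hS1, hS2, -⟩ := hpath _ Fintype.card_pos le_rfl
  rwa [(Finset.card_eq_iff_eq_univ S).1 hS1] at hS2

end Built

/-- The number of homomorphisms from a graph of treewidth at most `k` is the value of a closed
term with `k + 1` variables. -/
theorem exists_term_eval_eq_hom {k : ℕ} {U : Type} [Finite U] (F : SimpleGraph U)
    (hF : treewidth F ≤ k) : ∃ t : Term (Fin (k + 1)), t.freeVars = ∅ ∧
      ∀ (V : Type) [Fintype V] (G : SimpleGraph V), t.eval G (fun _ => none) = hom F G := by
  classical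
  have := Fintype.ofFinite U
  obtain ⟨T, _, D, hD⟩ := treewidth_mem F
  have hcard : ∀ t, (D.bag t).card ≤ k + 1 := by
    intro t
    have h1 : (D.bag t).card ≤ Finset.univ.sup fun t => (D.bag t).card :=
      Finset.le_sup (f := fun t => (D.bag t).card) (Finset.mem_univ t)
    simp only [TreeDecomposition.width] at hD
    omega
  obtain ⟨f, hf⟩ := D.built_univ.exists_injOn hcard
  obtain ⟨l, hl1, hl2, h⟩ := D.built_univ.exists_term (f := f) fun t => hf t (Finset.mem_univ t)
  obtain ⟨R, hR1, hR2, hR3⟩ := h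
    (fun t => .prodList ((((D.bag t ×ˢ D.bag t).filter fun e => F.Adj e.1 e.2).toList).map
      fun e => .edge e.1 e.2)) (by
      intro t
      refine Term.freeVars_prodList_subset _ fun u hu => ?_
      simp only [List.mem_map, Finset.mem_toList, Finset.mem_filter, Finset.mem_product] at hu
      obtain ⟨e, ⟨⟨h1, h2⟩, -⟩, rfl⟩ := hu
      rintro x (rfl | rfl)
      · exact h1
      · exact h2) (by
      intro t
      refine Term.captureFree_prodList _ fun u hu => ?_
      simp only [List.mem_map] at hu
      obtain ⟨e, -, rfl⟩ := hu
      trivial)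
  refine ⟨R.map f, ?_, fun V _ G => ?_⟩
  · have := R.freeVars_map_subset f
    rwa [hR1, Set.image_empty, Set.subset_empty_iff] at this
  · rw [Term.eval_map f G R hR2]
    refine (hR3 V G).trans ?_
    rw [sumOver_eq_sum l hl1 fun u => (hl2 u).2 ⟨(D.cover_vertex u).choose, Finset.mem_univ _,
      (D.cover_vertex u).choose_spec⟩]
    have hprod : ∀ g : U → V, (∏ t, (Term.prodList ((((D.bag t ×ˢ D.bag t).filter
        fun e => F.Adj e.1 e.2).toList).map fun e => .edge e.1 e.2)).eval G fun u => some (g u)) =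
        if ∀ u v, F.Adj u v → G.Adj (g u) (g v) then 1 else 0 := by
      intro g
      simp only [Term.eval_prodList, List.map_map]
      split_ifs with hg
      · refine Finset.prod_eq_one fun t _ => List.prod_eq_one ?_
        intro x hx
        simp only [List.mem_map, Finset.mem_toList, Finset.mem_filter] at hx
        obtain ⟨e, ⟨-, he⟩, rfl⟩ := hx
        exact iverson_of ⟨_, _, rfl, rfl, hg _ _ he⟩
      · push Not at hg
        obtain ⟨u, v, huv, hg⟩ := hg
        obtain ⟨t, hu, hv⟩ := D.cover_edge u v huv
        refine Finset.prod_eq_zero (Finset.mem_univ t) (List.prod_eq_zero ?_)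
        simp only [List.mem_map, Finset.mem_toList, Finset.mem_filter, Finset.mem_product]
        refine ⟨(u, v), ⟨⟨hu, hv⟩, huv⟩, iverson_of_not ?_⟩
        rintro ⟨a, b, h1, h2, h3⟩
        cases h1
        cases h2
        exact hg h3
    simp only [hprod]
    rw [Finset.sum_boole, Nat.cast_id, hom, ← Fintype.card_subtype, ← Nat.card_eq_fintype_card]
    exact Nat.card_congr
      { toFun g := ⟨g.1, fun {u v} h => g.2 u v h⟩
        invFun g := ⟨g, fun u v h => g.map_rel h⟩
        left_inv _ := rfl
        right_inv _ := rfl }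

theorem Formula.realize_iso {p : ℕ} {α : Type*} [DecidableEq α] {V W : Type*} {G : SimpleGraph V}
    {H : SimpleGraph W} (e : G ≃g H) (φ : Formula p α) :
    ∀ s : α → Option V, φ.Realize H (fun x => (s x).map e) ↔ φ.Realize G s := by
  induction φ with
  | eq x y =>
    intro s
    simp only [Realize, Option.map_eq_some_iff]
    constructor
    · rintro ⟨_, ⟨a, h1, rfl⟩, b, h2, h3⟩
      exact ⟨a, h1, e.injective h3 ▸ h2⟩
    · rintro ⟨a, h1, h2⟩
      exact ⟨e a, ⟨a, h1, rfl⟩, a, h2, rfl⟩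
  | edge x y =>
    intro s
    simp only [Realize, Option.map_eq_some_iff]
    constructor
    · rintro ⟨_, _, ⟨a, h1, rfl⟩, ⟨b, h2, rfl⟩, h3⟩
      exact ⟨a, b, h1, h2, e.map_adj_iff.1 h3⟩
    · rintro ⟨a, b, h1, h2, h3⟩
      exact ⟨_, _, ⟨a, h1, rfl⟩, ⟨b, h2, rfl⟩, e.map_adj_iff.2 h3⟩
  | neg φ ih => exact fun s => not_congr (ih s)
  | and φ ψ ih1 ih2 => exact fun s => and_congr (ih1 s) (ih2 s)
  | or φ ψ ih1 ih2 => exact fun s => or_congr (ih1 s) (ih2 s)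
  | existsMod c x φ ih =>
    intro s
    have : Nat.card {a // φ.Realize H (Function.update (fun x => (s x).map e) x (some a))} =
        Nat.card {a // φ.Realize G (Function.update s x (some a))} := by
      refine (Nat.card_congr (e.toEquiv.subtypeEquiv fun a => ?_)).symm
      rw [← ih]
      refine iff_of_eq (congrArg _ (funext fun y => ?_))
      by_cases hyx : y = x
      · subst hyx
        simp
      · simp [Function.update_of_ne hyx]
    simp only [Realize, this]

theorem Formula.holds_iso {p : ℕ} {α : Type*} [DecidableEq α] {V W : Type*} {G : SimpleGraph V}
    {H : SimpleGraph W} (e : G ≃g H) (φ : Formula p α) : φ.Holds H ↔ φ.Holds G :=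
  φ.realize_iso e fun _ => none

theorem hom_congr_right {U V W : Type*} (F : SimpleGraph U) {G : SimpleGraph V}
    {H : SimpleGraph W} (e : G ≃g H) : hom F G = hom F H :=
  Nat.card_congr
    { toFun f := e.toHom.comp f
      invFun f := e.symm.toHom.comp f
      left_inv f := by ext x; simp
      right_inv f := by ext x; simp }

theorem exists_iso_type {V : Type*} [Finite V] (G : SimpleGraph V) :
    ∃ (n : ℕ) (G' : SimpleGraph (Fin n)), Nonempty (G ≃g G') := by
  obtain ⟨n, ⟨e⟩⟩ := Finite.exists_equiv_fin V
  exact ⟨n, G.map e.toEmbedding, ⟨SimpleGraph.Iso.map e G⟩⟩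

/-- For every graph `F` of treewidth at most `k` there are sentences with `k + 1` variables that
express the number of homomorphisms from `F` modulo `p`. -/
theorem exists_sentence_holds_iff {p k : ℕ} [NeZero p] {U : Type} [Finite U] (F : SimpleGraph U)
    (hF : treewidth F ≤ k) (c : ZMod p) : ∃ φ : Formula p (Fin (k + 1)), φ.IsSentence ∧
      ∀ (V : Type) [Fintype V] (G : SimpleGraph V), φ.Holds G ↔ (hom F G : ZMod p) = c := by
  obtain ⟨t, ht1, ht2⟩ := exists_term_eval_eq_hom F hF
  obtain ⟨φ, h1, h2⟩ := t.definable_eval_eq c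
  refine ⟨φ, Set.subset_empty_iff.1 (ht1 ▸ h1), fun V _ G => ?_⟩
  rw [← ht2]
  exact h2 V G _

end ModHom

theorem mainTheorem3 {V W : Type*} [Finite V] [Finite W] (p k : ℕ) (hp : p.Prime)
    (G : SimpleGraph V) (H : SimpleGraph W) :
    ModHom.HomIndistinguishableTW p k G H ↔ ModHom.ModCountingEquiv (k + 1) p G H := by
  have := Fact.mk hp
  constructor
  · intro h φ _
    have := Fintype.ofFinite V
    have := Fintype.ofFinite W
    exact ModHom.Term.holds_iff_of_eval_eq
      (ModHom.Term.eval_eq_of_homIndistinguishable h) φ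
  · intro h U _ F hF
    obtain ⟨m, G', ⟨e⟩⟩ := ModHom.exists_iso_type G
    obtain ⟨n, H', ⟨e'⟩⟩ := ModHom.exists_iso_type H
    rw [ModHom.hom_congr_right F e, ModHom.hom_congr_right F e', ← ZMod.natCast_eq_natCast_iff]
    obtain ⟨φ, h1, h2⟩ := ModHom.exists_sentence_holds_iff F hF (ModHom.hom F H' : ZMod p)
    rw [← h2, φ.holds_iso e, h φ h1, ← φ.holds_iso e', h2]
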